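/- **Setting.** A weighted graph on the nodes $\{1,\dots,p\}$, $p\ge 2$, is given by a symmetric matrix $W=(w_{ij})$ with $w_{ij}\ge 0$ and $w_{ii}=0$; its edges are the pairs with $w_{ij}>0$, and its combinatorial Laplacian is $L=D-W$, where $D$ is the diagonal matrix of the degrees $d_i=\sum_j w_{ij}$. For an edge set $\mathcal E$, let $\mathcal L_p(\mathcal E)$ be the set of Laplacians of connected weighted graphs with edge set contained in $\mathcal E$. Write $L^\dagger$ for the Moore–Penrose pseudo-inverse and $\det^\dagger L$ for the product of the nonzero eigenvalues. For data $x^{(1)},\dots,x^{(n)}\in\mathbb R^p$ let $S=\frac1n\sum_k x^{(k)}(x^{(k)})^\top$ and let $$\mathcal E_\exists=\Big\{(i,j):\ \tfrac1n\sum_{k=1}^n\big(x^{(k)}_i-x^{(k)}_j\big)^2>0\Big\}.$$ The combinatorial graph Laplacian estimator (CGLE) is $$\widehat L=\operatorname*{argmin}_{L\in\mathcal L_p(\mathcal E)}\ \big(-\log\det{}^\dagger L+\operatorname{tr}(LS)\big).$$ The symmetrized Stein loss is $L^{ss}(L_1,L_2)=\frac12\big(\ell^s(L_1,L_2)+\ell^s(L_2,L_1)\big)$,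 where $$\ell^s(L_1,L_2)=\frac{\operatorname{tr}(L_1L_2^\dagger)-\log\det^\dagger L_1+\log\det^\dagger L_2}{p-1}-1 .$$ **Assumption** (with constants $c_0,c_1>0$). The data $x^{(1)},\dots,x^{(n)}$ are i.i.d. copies of a random vector $x\in\mathbb R^p$ with mean zero and covariance matrix $(L^\star)^\dagger$, where $L^\star$ is the Laplacian of a weighted graph with edge set $\mathcal E^\star$. With $\|Y\|_{\Psi_2}=\inf\{t>0:\mathbb E\,e^{Y^2/t^2}\le 2\}$, for every $u\in\mathbb R^p$ one has $\|u^\top x\|_{\Psi_2}<\infty$, $\ \mathbb E[|u^\top x|^r]^{1/r}\le c_0\|u^\top x\|_{\Psi_2}\sqrt r$ for all real $r\ge1$, and $\|u^\top x\|_{\Psi_2}^2\le \mathbb E[(u^\top x)^2]/c_1$. **Theorem 3.** There are constants $c'',C''>0$ depending only on $c_0,c_1$ such that the following holds. Let the Assumption hold, let $\mathcal E^\star$ be a tree, let $\mathcal E=\mathcal E^\star$, and let $n\ge c''\log p$. Then, with probability at least $1-2/p^2$, one has $\mathcal E\subset\mathcal E_\exists$, the CGLE $\widehat L$ exists and is unique,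 and $$L^{ss}(\widehat L,L^\star)\le C''\,\frac{\log p}{n}.$$ -/

import Mathlib

open MeasureTheory ProbabilityTheory
open scoped ENNReal Matrix

/-! ### Weighted graphs and their combinatorial Laplacians -/

/-- An undirected weighted graph on the nodes `0, …, p - 1`, given by its weight matrix. -/
structure WeightedGraph (p : ℕ) where
  /-- The weight matrix. -/
  W : Matrix (Fin p) (Fin p) ℝ
  symm : ∀ i j, W i j = W j i
  nonneg : ∀ i j, 0 ≤ W i j
  no_loops : ∀ i, W i i = 0

namespace WeightedGraph

/-- The edge set: `i` and `j` are joined if and only if the weight `w i j` is positive. -/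
def graph {p : ℕ} (G : WeightedGraph p) : SimpleGraph (Fin p) where
  Adj i j := 0 < G.W i j
  symm := ⟨fun i j h => by rw [G.symm j i]; exact h⟩
  loopless := ⟨fun i h => by rw [G.no_loops i] at h; exact lt_irrefl _ h⟩

/-- The combinatorial graph Laplacian `L = D - W`, where `D` is the diagonal matrix of degrees. -/
def laplacian {p : ℕ} (G : WeightedGraph p) : Matrix (Fin p) (Fin p) ℝ :=
  Matrix.diagonal (fun i => ∑ j, G.W i j) - G.W

end WeightedGraph

/-- The set of combinatorial Laplacians of connected weighted graphs
with edge set contained in `E`. -/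
def laplacianSet {p : ℕ} (E : SimpleGraph (Fin p)) : Set (Matrix (Fin p) (Fin p) ℝ) :=
  {L | ∃ G : WeightedGraph p, G.graph ≤ E ∧ G.graph.Connected ∧ L = G.laplacian}

/-! ### Pseudo-determinant and pseudo-inverse -/

/-- The product of the nonzero eigenvalues, with multiplicity, of a real symmetric matrix
(all the eigenvalues of such a matrix are real). -/
noncomputable def pdet {p : ℕ} (A : Matrix (Fin p) (Fin p) ℝ) : ℝ :=
  open Classical in (A.charpoly.roots.filter (fun x => x ≠ 0)).prod

/-- The four Penrose equations: `B` is the Moore-Penrose pseudo-inverse of the real matrix `A`. -/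
structure IsMoorePenrose {p : ℕ} (A B : Matrix (Fin p) (Fin p) ℝ) : Prop where
  mul_mul_left : A * B * A = A
  mul_mul_right : B * A * B = B
  symm_left : (A * B)ᵀ = A * B
  symm_right : (B * A)ᵀ = B * A

open Classical in
/-- The Moore-Penrose pseudo-inverse of a real square matrix. -/
noncomputable def pinv {p : ℕ} (A : Matrix (Fin p) (Fin p) ℝ) : Matrix (Fin p) (Fin p) ℝ :=
  if h : ∃ B, IsMoorePenrose A B then h.choose else 0

theorem IsMoorePenrose.unique {p : ℕ} {A B C : Matrix (Fin p) (Fin p) ℝ}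
    (hB : IsMoorePenrose A B) (hC : IsMoorePenrose A C) : B = C := by
  have h1 : A * B = A * C := by
    calc A * B = (A * B)ᵀ := hB.symm_left.symm
      _ = (A * C * (A * B))ᵀ := by rw [← mul_assoc, hC.mul_mul_left]
      _ = A * B * (A * C) := by rw [Matrix.transpose_mul, hB.symm_left, hC.symm_left]
      _ = A * C := by rw [← mul_assoc, hB.mul_mul_left]
  have h2 : B * A = C * A := by
    calc B * A = (B * A)ᵀ := hB.symm_right.symm
      _ = (B * A * (C * A))ᵀ := by rw [mul_assoc, ← mul_assoc A C A, hC.mul_mul_left]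
      _ = C * A * (B * A) := by rw [Matrix.transpose_mul, hB.symm_right, hC.symm_right]
      _ = C * A := by rw [mul_assoc, ← mul_assoc A B A, hB.mul_mul_left]
  calc B = B * A * B := hB.mul_mul_right.symm
    _ = C * A * C := by rw [h2, mul_assoc, h1, ← mul_assoc]
    _ = C := hC.mul_mul_right

theorem exists_isMoorePenrose {p : ℕ} {A : Matrix (Fin p) (Fin p) ℝ} (hA : A.IsHermitian) :
    ∃ B, IsMoorePenrose A B := by
  obtain ⟨U, V, d, hVU, hV, hAe⟩ : ∃ (U V : Matrix (Fin p) (Fin p) ℝ) (d : Fin p → ℝ),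
      V * U = 1 ∧ V = Uᵀ ∧ A = U * Matrix.diagonal d * V := by
    refine ⟨hA.eigenvectorUnitary, star (hA.eigenvectorUnitary : Matrix (Fin p) (Fin p) ℝ),
      hA.eigenvalues, ?_, ?_, ?_⟩
    · exact Unitary.coe_star_mul_self _
    · rw [Matrix.star_eq_conjTranspose, Matrix.conjTranspose_eq_transpose_of_trivial]
    · have h := hA.spectral_theorem
      rw [Unitary.conjStarAlgAut_apply] at h
      exact h
  have key : ∀ a b : Fin p → ℝ, U * Matrix.diagonal a * V * (U * Matrix.diagonal b * V)
      = U * Matrix.diagonal (fun i => a i * b i) * V := by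
    intro a b
    calc _ = U * Matrix.diagonal a * (V * U) * Matrix.diagonal b * V := by
          simp only [mul_assoc]
      _ = _ := by rw [hVU, mul_one, mul_assoc U, Matrix.diagonal_mul_diagonal]
  have keyT : ∀ a : Fin p → ℝ, (U * Matrix.diagonal a * V)ᵀ = U * Matrix.diagonal a * V := by
    intro a
    rw [hV]
    simp [Matrix.transpose_mul, mul_assoc]
  refine ⟨U * Matrix.diagonal (fun i => (d i)⁻¹) * V, ?_, ?_, ?_, ?_⟩ <;> rw [hAe]
  · rw [key, key]
    simp
  · rw [key, key]
    congr 3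
    funext i
    by_cases h : d i = 0 <;> simp [h]
  · rw [key, keyT]
  · rw [key, keyT]

theorem isMoorePenrose_pinv {p : ℕ} {A : Matrix (Fin p) (Fin p) ℝ} (hA : A.IsHermitian) :
    IsMoorePenrose A (pinv A) := by
  have h := exists_isMoorePenrose hA
  unfold pinv
  rw [dif_pos h]
  exact h.choose_spec

/-! ### The estimator -/

/-- The sample covariance matrix `S = (1/n) ∑ k, x k (x k)ᵀ`. -/
noncomputable def sampleCov {p n : ℕ} (x : Fin n → Fin p → ℝ) : Matrix (Fin p) (Fin p) ℝ :=
  (n : ℝ)⁻¹ • ∑ k, Matrix.vecMulVec (x k) (x k)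

/-- The data dependent distances `h i j = (1/n) ∑ k, (x k i - x k j)²`. -/
noncomputable def dataDist {p n : ℕ} (x : Fin n → Fin p → ℝ) (i j : Fin p) : ℝ :=
  (n : ℝ)⁻¹ * ∑ k, (x k i - x k j) ^ 2

/-- The data dependent graph whose edges are the pairs with `h i j > 0`. -/
def dataGraph {p n : ℕ} (x : Fin n → Fin p → ℝ) : SimpleGraph (Fin p) where
  Adj i j := 0 < dataDist x i j
  symm := ⟨fun i j h => by
    have e : dataDist x j i = dataDist x i j := by
      unfold dataDist
      congr 1
      exact Finset.sum_congr rfl fun k _ => by ring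
    rw [e]; exact h⟩
  loopless := ⟨fun i h => by simp [dataDist] at h⟩

/-- `Lhat` is a combinatorial graph Laplacian estimator for the edge constraint `E` and the sample
covariance `S`: it minimizes `- log det† L + tr (L S)` over the Laplacians of connected graphs
with edge set contained in `E`. -/
def IsCGLE {p : ℕ} (E : SimpleGraph (Fin p)) (S Lhat : Matrix (Fin p) (Fin p) ℝ) : Prop :=
  Lhat ∈ laplacianSet E ∧
    IsMinOn (fun L : Matrix (Fin p) (Fin p) ℝ => - Real.log (pdet L) + (L * S).trace)
      (laplacianSet E) Lhat

/-! ### The symmetrized Stein loss -/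

/-- Stein's loss for Laplacians of connected graphs. -/
noncomputable def steinLoss {p : ℕ} (L₁ L₂ : Matrix (Fin p) (Fin p) ℝ) : ℝ :=
  ((L₁ * pinv L₂).trace - Real.log (pdet L₁) + Real.log (pdet L₂)) / ((p : ℝ) - 1) - 1

/-- The symmetrized Stein loss. -/
noncomputable def symSteinLoss {p : ℕ} (L₁ L₂ : Matrix (Fin p) (Fin p) ℝ) : ℝ :=
  (steinLoss L₁ L₂ + steinLoss L₂ L₁) / 2

/-! ### Sub-Gaussian vectors -/

/-- The sub-Gaussian norm `inf {t > 0 : 𝔼 exp (Y² / t²) ≤ 2}` of a real random variable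
(`∞` if there is no such `t`). -/
noncomputable def psiTwoNorm {Ω : Type*} [MeasurableSpace Ω] (Y : Ω → ℝ) (μ : Measure Ω) : ℝ≥0∞ :=
  ⨅ (t : ℝ) (_ : 0 < t) (_ : ∫⁻ ω, ENNReal.ofReal (Real.exp (Y ω ^ 2 / t ^ 2)) ∂μ ≤ 2),
    ENNReal.ofReal t

/-- A random vector with law `ν` has mean zero and covariance matrix `Sig`,
and is sub-Gaussian with constants `c₀` and `c₁`. -/
structure SubGaussianLaw {p : ℕ} (c₀ c₁ : ℝ) (Sig : Matrix (Fin p) (Fin p) ℝ)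
    (ν : Measure (Fin p → ℝ)) : Prop where
  memLp : ∀ i, MemLp (fun v : Fin p → ℝ => v i) 2 ν
  mean_zero : ∀ i, ∫ v, v i ∂ν = 0
  covariance_eq : ∀ i j, cov[fun v : Fin p → ℝ => v i, fun v => v j; ν] = Sig i j
  /-- The sub-Gaussian norm of each one-dimensional marginal is finite. -/
  psiTwo_lt_top : ∀ u : Fin p → ℝ, psiTwoNorm (fun v => u ⬝ᵥ v) ν < ∞
  /-- `𝔼[|uᵀx|^r]^(1/r) ≤ c₀ ‖uᵀx‖ √r` for every real `r ≥ 1`. -/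
  moments : ∀ (u : Fin p → ℝ) (r : ℝ), 1 ≤ r →
    eLpNorm (fun v => u ⬝ᵥ v) (ENNReal.ofReal r) ν
      ≤ ENNReal.ofReal c₀ * psiTwoNorm (fun v => u ⬝ᵥ v) ν * ENNReal.ofReal (Real.sqrt r)
  /-- `‖uᵀx‖² ≤ 𝔼[(uᵀx)²] / c₁`. -/
  psiTwo_le : ∀ u : Fin p → ℝ,
    psiTwoNorm (fun v => u ⬝ᵥ v) ν ^ 2 ≤ ENNReal.ofReal ((∫ v, (u ⬝ᵥ v) ^ 2 ∂ν) / c₁)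

/-! ### The oriented incidence matrix -/

namespace SimpleGraph

variable {V : Type*}

/-! On a tree everything decouples over the edges. Let `B` be the oriented incidence matrix, so that
a Laplacian is `B diag(w) Bᵀ`. A tree has `p - 1` edges and `B` has trivial kernel, so the Gram
matrix `BᵀB` is invertible. Hence `det†` of the Laplacian is `det (BᵀB)` times the product of the
weights (`pdet_weightedLap`), and `Bᵀ L† B = diag(1/w)` (`transpose_mul_pinv_weightedLap_mul`).

With `h e` the data distance across `e`, the objective is a constant plus a sum of terms `w e * h e
- log (w e)`, minimized exactly at `w e = 1 / h e` (`isCGLE_iff_of_isTree`). With `w` now the true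
weights and `s e = w e * h e`, the symmetrized loss of the estimator is the average over the edges
of `(s + 1/s - 2) / 2`, which is quadratic in `s - 1`.

The difference of the data across `e` has variance `1 / w e`, so `s e` is an empirical mean of
i.i.d. sub-exponential variables of mean one. A Bernstein bound (`measureReal_abs_sum_ge_le`) and a
union bound over the edges give `|s e - 1| ≤ δ` for all `e`, with `δ²` of order `log p / n`. -/

theorem mk_out_edge {E : SimpleGraph V} (e : E.edgeSet) :
    s((Quot.out e.1).1, (Quot.out e.1).2) = e.1 :=
  Quot.out_eq e.1

theorem adj_out_edge {E : SimpleGraph V} (e : E.edgeSet) :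
    E.Adj (Quot.out e.1).1 (Quot.out e.1).2 := by
  rw [← mem_edgeSet, mk_out_edge]
  exact e.2

theorem IsTree.card_edgeSet [Fintype V] {E : SimpleGraph V} [Fintype E.edgeSet] (hE : E.IsTree) :
    Fintype.card E.edgeSet + 1 = Fintype.card V := by
  rw [← hE.card_edgeFinset, edgeFinset_card]

variable [DecidableEq V]

/-- The incidence matrix of a graph, each edge being oriented in an arbitrary way. -/
noncomputable def orientedIncMatrix (E : SimpleGraph V) : Matrix V E.edgeSet ℝ :=
  Matrix.of fun v e => Pi.single (M := fun _ => ℝ) (Quot.out e.1).1 1 v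
    - Pi.single (M := fun _ => ℝ) (Quot.out e.1).2 1 v

theorem transpose_orientedIncMatrix_mulVec [Fintype V] (E : SimpleGraph V) (x : V → ℝ)
    (e : E.edgeSet) :
    ((orientedIncMatrix E)ᵀ *ᵥ x) e = x (Quot.out e.1).1 - x (Quot.out e.1).2 := by
  simp [Matrix.mulVec, dotProduct, orientedIncMatrix, sub_mul, Finset.sum_sub_distrib,
    Pi.single_apply]

/-- Reversing an edge flips both signs, so the product does not depend on the orientation. -/
theorem orientedIncMatrix_mul_of_ne (E : SimpleGraph V) {i j : V} (hij : i ≠ j) (e : E.edgeSet) :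
    orientedIncMatrix E i e * orientedIncMatrix E j e = if e.1 = s(i, j) then -1 else 0 := by
  have hne := (adj_out_edge e).ne
  rw [← mk_out_edge e]
  simp only [orientedIncMatrix, Matrix.of_apply, Pi.single_apply, Sym2.eq_iff]
  generalize (Quot.out e.1).1 = a at *
  generalize (Quot.out e.1).2 = b at *
  by_cases h1 : i = a <;> by_cases h2 : i = b <;> by_cases h3 : j = a <;> by_cases h4 : j = b <;>
    simp_all [eq_comm]

variable {E : SimpleGraph V} [Fintype E.edgeSet]

/-- The Laplacian with edge weights `w`, factored through the incidence matrix. -/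
noncomputable def weightedLap (E : SimpleGraph V) [Fintype E.edgeSet] (w : E.edgeSet → ℝ) :
    Matrix V V ℝ :=
  orientedIncMatrix E * Matrix.diagonal w * (orientedIncMatrix E)ᵀ

theorem weightedLap_mulVec_one [Fintype V] (w : E.edgeSet → ℝ) : weightedLap E w *ᵥ 1 = 0 := by
  have h : (orientedIncMatrix E)ᵀ *ᵥ (1 : V → ℝ) = 0 := by
    ext e
    rw [transpose_orientedIncMatrix_mulVec]
    simp
  rw [weightedLap, ← Matrix.mulVec_mulVec, h, Matrix.mulVec_zero]

theorem weightedLap_apply_of_adj (w : E.edgeSet → ℝ) {i j : V} (h : E.Adj i j) :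
    weightedLap E w i j = - w ⟨s(i, j), h⟩ := by
  have : ∀ e : E.edgeSet, (orientedIncMatrix E * Matrix.diagonal w) i e * orientedIncMatrix E j e
      = if e = ⟨s(i, j), h⟩ then - w ⟨s(i, j), h⟩ else 0 := by
    intro e
    rw [Matrix.mul_diagonal, mul_right_comm, orientedIncMatrix_mul_of_ne E h.ne]
    by_cases he : e = ⟨s(i, j), h⟩
    · simp [he]
    · have : e.1 ≠ s(i, j) := fun h' => he (Subtype.ext h')
      simp [he, this]
  rw [weightedLap, Matrix.mul_apply]
  simp only [Matrix.transpose_apply, this]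
  simp

theorem weightedLap_apply_of_not_adj (w : E.edgeSet → ℝ) {i j : V} (hij : i ≠ j)
    (h : ¬ E.Adj i j) : weightedLap E w i j = 0 := by
  rw [weightedLap, Matrix.mul_apply]
  refine Finset.sum_eq_zero fun e _ => ?_
  rw [Matrix.mul_diagonal, Matrix.transpose_apply, mul_right_comm,
    orientedIncMatrix_mul_of_ne E hij, if_neg, zero_mul]
  intro he
  exact h (by rw [← mem_edgeSet, ← he]; exact e.2)

theorem weightedLap_isHermitian (w : E.edgeSet → ℝ) : (weightedLap E w).IsHermitian := by
  rw [Matrix.IsHermitian, Matrix.conjTranspose_eq_transpose_of_trivial, weightedLap]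
  simp [Matrix.transpose_mul, Matrix.mul_assoc]

/-- A vector killed by `Bᵀ` is constant along edges, hence constant by connectedness. So `B` has
rank at least `p - 1`, which is its number of columns. -/
theorem IsTree.ker_orientedIncMatrix [Fintype V] (hE : E.IsTree) :
    LinearMap.ker (orientedIncMatrix E).mulVecLin = ⊥ := by
  have hker : LinearMap.ker (orientedIncMatrix E)ᵀ.mulVecLin
      ≤ Submodule.span ℝ {(1 : V → ℝ)} := by
    intro x hx
    rw [LinearMap.mem_ker, Matrix.mulVecLin_apply] at hx
    have hadj : ∀ i j, E.Adj i j → x i = x j := by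
      intro i j hij
      have h := congrFun hx ⟨s(i, j), hij⟩
      rw [transpose_orientedIncMatrix_mulVec, Pi.zero_apply, sub_eq_zero] at h
      have h2 := mk_out_edge (E := E) ⟨s(i, j), hij⟩
      rw [Sym2.eq_iff] at h2
      rcases h2 with ⟨h3, h4⟩ | ⟨h3, h4⟩ <;> rw [h3, h4] at h
      · exact h
      · exact h.symm
    have hreach : ∀ i j, E.Reachable i j → x i = x j := by
      rintro i j ⟨q⟩
      induction q with
      | nil => rfl
      | cons h _ ih => exact (hadj _ _ h).trans ih
    obtain ⟨v⟩ := hE.connected.nonempty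
    rw [Submodule.mem_span_singleton]
    refine ⟨x v, ?_⟩
    ext i
    simpa using hreach v i (hE.connected.preconnected v i)
  have h1 : Module.finrank ℝ (LinearMap.ker (orientedIncMatrix E)ᵀ.mulVecLin) ≤ 1 :=
    (Submodule.finrank_mono hker).trans ((finrank_span_le_card _).trans (by simp))
  have h2 := LinearMap.finrank_range_add_finrank_ker (orientedIncMatrix E)ᵀ.mulVecLin
  have h3 := LinearMap.finrank_range_add_finrank_ker (orientedIncMatrix E).mulVecLin
  have h4 : (orientedIncMatrix E)ᵀ.rank = (orientedIncMatrix E).rank := Matrix.rank_transpose _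
  rw [Matrix.rank, Matrix.rank] at h4
  rw [Module.finrank_fintype_fun_eq_card] at h2 h3
  have h5 := hE.card_edgeSet
  rw [← Submodule.finrank_eq_zero]
  omega

theorem IsTree.isUnit_det_gram [Fintype V] (hE : E.IsTree) :
    IsUnit ((orientedIncMatrix E)ᵀ * orientedIncMatrix E).det := by
  rw [← Matrix.isUnit_iff_isUnit_det, ← Matrix.mulVec_injective_iff_isUnit]
  have h := Matrix.ker_mulVecLin_transpose_mul_self (orientedIncMatrix E)
  rw [hE.ker_orientedIncMatrix, LinearMap.ker_eq_bot] at h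
  exact h

end SimpleGraph

open SimpleGraph

/-! ### Pseudo-determinant and pseudo-inverse of a tree Laplacian -/

theorem transpose_mul_sampleCov_mul {p n : ℕ} {E : SimpleGraph (Fin p)} (x : Fin n → Fin p → ℝ) (e : E.edgeSet) :
    ((orientedIncMatrix E)ᵀ * sampleCov x * orientedIncMatrix E) e e
      = dataDist x (Quot.out e.1).1 (Quot.out e.1).2 := by
  have h : ∀ k, ((orientedIncMatrix E)ᵀ * Matrix.vecMulVec (x k) (x k) * orientedIncMatrix E) e e
      = (x k (Quot.out e.1).1 - x k (Quot.out e.1).2) ^ 2 := by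
    intro k
    rw [Matrix.mul_vecMulVec, Matrix.vecMulVec_mul, Matrix.vecMulVec_apply,
      ← Matrix.mulVec_transpose, transpose_orientedIncMatrix_mulVec, sq]
  rw [sampleCov, dataDist, Matrix.mul_smul, Matrix.smul_mul, Matrix.smul_apply, smul_eq_mul,
    Matrix.mul_sum, Matrix.sum_mul, Matrix.sum_apply]
  simp only [h]

section TreeLaplacian

variable {p : ℕ} {E : SimpleGraph (Fin p)} [Fintype E.edgeSet]

/-- Swapping the factors of `(B D) Bᵀ` turns the characteristic polynomial into `X` times that of
`Bᵀ B D`, which is invertible: the only zero eigenvalue comes from `X`. -/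
theorem pdet_weightedLap (hE : E.IsTree) {w : E.edgeSet → ℝ} (hw : ∀ e, 0 < w e) :
    pdet (weightedLap E w)
      = ((orientedIncMatrix E)ᵀ * orientedIncMatrix E).det * ∏ e, w e := by
  classical
  set B := orientedIncMatrix E with hB
  have hcard := hE.card_edgeSet
  have hsplit := (weightedLap_isHermitian w).splits_charpoly
  have hchar : (weightedLap E w).charpoly
      = Polynomial.X * (Bᵀ * (B * Matrix.diagonal w)).charpoly := by
    rw [weightedLap, Matrix.charpoly_mul_comm_of_le _ _ (by omega), ← hcard, Nat.add_sub_cancel_left,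
      pow_one]
  have hdet : (Bᵀ * (B * Matrix.diagonal w)).det = (Bᵀ * B).det * ∏ e, w e := by
    rw [← Matrix.mul_assoc, Matrix.det_mul, Matrix.det_diagonal]
  have hdet0 : (Bᵀ * (B * Matrix.diagonal w)).det ≠ 0 := by
    rw [hdet]
    exact mul_ne_zero hE.isUnit_det_gram.ne_zero (Finset.prod_pos fun e _ => hw e).ne'
  -- `Bᵀ B D` need not be symmetric; its real splitting is inherited from the Laplacian, whose
  -- characteristic polynomial it divides.
  have hs : (Bᵀ * (B * Matrix.diagonal w)).charpoly.Splits := by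
    refine hsplit.of_dvd (Matrix.charpoly_monic _).ne_zero ?_
    rw [hchar]
    exact dvd_mul_left _ _
  have hprod := Matrix.det_eq_prod_roots_charpoly_of_splits hs
  have hne : ∀ x ∈ (Bᵀ * (B * Matrix.diagonal w)).charpoly.roots, x ≠ 0 := by
    rintro x hx rfl
    exact hdet0 (hprod.trans (Multiset.prod_eq_zero hx))
  have hroots : (weightedLap E w).charpoly.roots
      = {0} + (Bᵀ * (B * Matrix.diagonal w)).charpoly.roots := by
    rw [hchar, Polynomial.roots_mul, Polynomial.roots_X]
    rw [← hchar]
    exact (Matrix.charpoly_monic _).ne_zero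
  rw [pdet, hroots, Multiset.filter_add, Multiset.filter_eq_self.2 hne, ← hdet, hprod]
  simp [Multiset.filter_singleton]

theorem gram_det_pos (hE : E.IsTree) :
    0 < ((orientedIncMatrix E)ᵀ * orientedIncMatrix E).det := by
  have h : ((orientedIncMatrix E)ᵀ * orientedIncMatrix E).PosSemidef := by
    have := Matrix.posSemidef_conjTranspose_mul_self (orientedIncMatrix E)
    rwa [Matrix.conjTranspose_eq_transpose_of_trivial] at this
  exact lt_of_le_of_ne h.det_nonneg hE.isUnit_det_gram.ne_zero.symm

theorem log_pdet_weightedLap (hE : E.IsTree) {w : E.edgeSet → ℝ} (hw : ∀ e, 0 < w e) :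
    Real.log (pdet (weightedLap E w))
      = Real.log ((orientedIncMatrix E)ᵀ * orientedIncMatrix E).det + ∑ e, Real.log (w e) := by
  rw [pdet_weightedLap hE hw, Real.log_mul (gram_det_pos hE).ne'
    (Finset.prod_pos fun e _ => hw e).ne', Real.log_prod fun e _ => (hw e).ne']

/-- Both products with the Laplacian reduce to `B (BᵀB)⁻¹ Bᵀ`, the orthogonal projection onto the
range of `B`. -/
theorem pinv_weightedLap (hE : E.IsTree) {w : E.edgeSet → ℝ} (hw : ∀ e, 0 < w e) :
    pinv (weightedLap E w) = orientedIncMatrix E *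
      (((orientedIncMatrix E)ᵀ * orientedIncMatrix E)⁻¹ * Matrix.diagonal (fun e => (w e)⁻¹) *
        ((orientedIncMatrix E)ᵀ * orientedIncMatrix E)⁻¹) * (orientedIncMatrix E)ᵀ := by
  refine (isMoorePenrose_pinv (weightedLap_isHermitian w)).unique ?_
  have hU := hE.isUnit_det_gram
  have hMT : (((orientedIncMatrix E)ᵀ * orientedIncMatrix E)⁻¹)ᵀ
      = ((orientedIncMatrix E)ᵀ * orientedIncMatrix E)⁻¹ := by
    rw [Matrix.transpose_nonsing_inv, Matrix.transpose_mul, Matrix.transpose_transpose]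
  have hD : Matrix.diagonal w * Matrix.diagonal (fun e => (w e)⁻¹) = 1 := by
    rw [Matrix.diagonal_mul_diagonal, ← Matrix.diagonal_one]
    congr 1
    ext e
    exact mul_inv_cancel₀ (hw e).ne'
  have hD' : Matrix.diagonal (fun e => (w e)⁻¹) * Matrix.diagonal w = 1 := by
    rw [Matrix.diagonal_mul_diagonal, ← Matrix.diagonal_one]
    congr 1
    ext e
    exact inv_mul_cancel₀ (hw e).ne'
  unfold weightedLap
  set B := orientedIncMatrix E
  set M := Bᵀ * B with hM
  set D := Matrix.diagonal w
  set D' := Matrix.diagonal (fun e => (w e)⁻¹)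
  have h1 : B * D * Bᵀ * (B * (M⁻¹ * D' * M⁻¹) * Bᵀ) = B * M⁻¹ * Bᵀ := by
    calc _ = B * (D * (M * M⁻¹) * D' * M⁻¹) * Bᵀ := by simp only [hM, Matrix.mul_assoc]
      _ = _ := by rw [Matrix.mul_nonsing_inv _ hU, Matrix.mul_one, hD, Matrix.one_mul]
  have h2 : B * (M⁻¹ * D' * M⁻¹) * Bᵀ * (B * D * Bᵀ) = B * M⁻¹ * Bᵀ := by
    calc _ = B * (M⁻¹ * (D' * ((M⁻¹ * M) * D))) * Bᵀ := by simp only [hM, Matrix.mul_assoc]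
      _ = _ := by rw [Matrix.nonsing_inv_mul _ hU, Matrix.one_mul, hD', Matrix.mul_one]
  have h3 : (B * M⁻¹ * Bᵀ)ᵀ = B * M⁻¹ * Bᵀ := by
    rw [Matrix.transpose_mul, Matrix.transpose_mul, hMT, Matrix.transpose_transpose,
      Matrix.mul_assoc]
  refine ⟨?_, ?_, ?_, ?_⟩
  · rw [h1]
    calc _ = B * (M⁻¹ * M) * D * Bᵀ := by simp only [hM, Matrix.mul_assoc]
      _ = _ := by rw [Matrix.nonsing_inv_mul _ hU, Matrix.mul_one]
  · rw [h2]
    calc _ = B * (M⁻¹ * M) * (M⁻¹ * D' * M⁻¹) * Bᵀ := by simp only [hM, Matrix.mul_assoc]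
      _ = _ := by rw [Matrix.nonsing_inv_mul _ hU, Matrix.mul_one]
  · rw [h1, h3]
  · rw [h2, h3]

/-- This evaluates the traces in the Stein loss and the variance of the data across an edge. -/
theorem transpose_mul_pinv_weightedLap_mul (hE : E.IsTree) {w : E.edgeSet → ℝ}
    (hw : ∀ e, 0 < w e) :
    (orientedIncMatrix E)ᵀ * pinv (weightedLap E w) * orientedIncMatrix E
      = Matrix.diagonal (fun e => (w e)⁻¹) := by
  have hU := hE.isUnit_det_gram
  rw [pinv_weightedLap hE hw]
  set B := orientedIncMatrix E
  set M := Bᵀ * B with hM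
  calc _ = (M * M⁻¹) * Matrix.diagonal (fun e => (w e)⁻¹) * (M⁻¹ * M) := by
        simp only [hM, Matrix.mul_assoc]
    _ = _ := by
        rw [Matrix.nonsing_inv_mul _ hU, Matrix.mul_nonsing_inv _ hU, Matrix.one_mul, Matrix.mul_one]

theorem trace_weightedLap_mul (w : E.edgeSet → ℝ) (A : Matrix (Fin p) (Fin p) ℝ) :
    (weightedLap E w * A).trace
      = ∑ e, w e * ((orientedIncMatrix E)ᵀ * A * orientedIncMatrix E) e e := by
  rw [weightedLap, Matrix.mul_assoc, Matrix.trace_mul_comm, ← Matrix.mul_assoc,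
    Matrix.trace_mul_comm, Matrix.trace]
  simp only [Matrix.diag_apply]
  refine Finset.sum_congr rfl fun e _ => ?_
  rw [← Matrix.mul_assoc, Matrix.mul_assoc, Matrix.diagonal_mul]

/-- Symmetrizing cancels the log-determinants, and the two `-1`s spread over the `p - 1` edges as
`-2` each. -/
theorem symSteinLoss_weightedLap (hp : 2 ≤ p) (hE : E.IsTree) {w w' : E.edgeSet → ℝ}
    (hw : ∀ e, 0 < w e) (hw' : ∀ e, 0 < w' e) :
    symSteinLoss (weightedLap E w) (weightedLap E w')
      = (∑ e, (w e / w' e + w' e / w e - 2)) / (2 * ((p : ℝ) - 1)) := by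
  have hcard : (Fintype.card E.edgeSet : ℝ) = (p : ℝ) - 1 := by
    have := hE.card_edgeSet
    rw [Fintype.card_fin] at this
    rw [eq_sub_iff_add_eq]
    exact_mod_cast this
  have hp1 : (p : ℝ) - 1 ≠ 0 := by
    have : (2 : ℝ) ≤ p := by exact_mod_cast hp
    linarith
  have htr : ∀ {w w' : E.edgeSet → ℝ}, (∀ e, 0 < w' e) →
      (weightedLap E w * pinv (weightedLap E w')).trace = ∑ e, w e / w' e := by
    intro w w' hw'
    rw [trace_weightedLap_mul, transpose_mul_pinv_weightedLap_mul hE hw']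
    simp [div_eq_mul_inv]
  rw [symSteinLoss, steinLoss, steinLoss, htr hw', htr hw, Finset.sum_sub_distrib,
    Finset.sum_add_distrib, Finset.sum_const, Finset.card_univ, nsmul_eq_mul, hcard]
  field_simp
  ring

/-! ### The estimator on a tree -/

/-- Both matrices have zero row sums, so comparing off-diagonal entries suffices. -/
theorem laplacian_eq_weightedLap (G : WeightedGraph p) (hG : G.graph ≤ E) :
    G.laplacian = weightedLap E fun e => G.W (Quot.out e.1).1 (Quot.out e.1).2 := by
  have hoff : ∀ i j, i ≠ j → G.laplacian i j
      = weightedLap E (fun e => G.W (Quot.out e.1).1 (Quot.out e.1).2) i j := by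
    intro i j hij
    have h0 : G.laplacian i j = - G.W i j := by
      simp [WeightedGraph.laplacian, Matrix.diagonal_apply_ne _ hij]
    rw [h0]
    by_cases h : E.Adj i j
    · rw [weightedLap_apply_of_adj _ h]
      have h2 := mk_out_edge (E := E) ⟨s(i, j), h⟩
      rw [Sym2.eq_iff] at h2
      rcases h2 with ⟨h3, h4⟩ | ⟨h3, h4⟩ <;> rw [h3, h4]
      rw [G.symm]
    · rw [weightedLap_apply_of_not_adj _ hij h, neg_eq_zero]
      exact le_antisymm (not_lt.1 fun h' => h (hG h')) (G.nonneg i j)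
  have hrow : ∀ A : Matrix (Fin p) (Fin p) ℝ, A *ᵥ 1 = 0 → ∀ i,
      A i i = - ∑ j ∈ Finset.univ.erase i, A i j := by
    intro A hA i
    have h := congrFun hA i
    simp only [Matrix.mulVec, dotProduct, Pi.one_apply, mul_one, Pi.zero_apply] at h
    rw [← Finset.add_sum_erase _ _ (Finset.mem_univ i)] at h
    linarith
  have hG1 : G.laplacian *ᵥ 1 = 0 := by
    ext i
    rw [WeightedGraph.laplacian, Matrix.sub_mulVec, Pi.sub_apply, Matrix.mulVec_diagonal]
    simp [Matrix.mulVec, dotProduct]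
  ext i j
  by_cases hij : i = j
  · subst hij
    rw [hrow _ hG1, hrow _ (weightedLap_mulVec_one _)]
    congr 1
    exact Finset.sum_congr rfl fun j hj => hoff i j (Finset.ne_of_mem_erase hj).symm
  · exact hoff i j hij

theorem laplacianSet_eq_of_isTree (hE : E.IsTree) :
    laplacianSet E = weightedLap E '' {w | ∀ e, 0 < w e} := by
  classical
  ext L
  constructor
  · rintro ⟨G, hG, hc, rfl⟩
    refine ⟨_, ?_, (laplacian_eq_weightedLap G hG).symm⟩
    intro e
    -- A tree is minimal among connected graphs, so no edge weight can vanish.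
    exact (isTree_iff_minimal_connected.1 hE).2 hc hG (adj_out_edge e)
  · rintro ⟨w, hw, rfl⟩
    let G : WeightedGraph p :=
      { W := Matrix.of fun i j => if h : E.Adj i j then w ⟨s(i, j), h⟩ else 0
        symm := by
          intro i j
          by_cases h : E.Adj i j
          · have h' := h.symm
            simp only [Matrix.of_apply, dif_pos h, dif_pos h']
            congr 2
            exact Sym2.eq_swap
          · have h' : ¬ E.Adj j i := fun h' => h h'.symm
            simp only [Matrix.of_apply, dif_neg h, dif_neg h']
        nonneg := by
          intro i j
          by_cases h : E.Adj i j
          · simpa [h] using (hw ⟨s(i, j), h⟩).le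
          · simp [h]
        no_loops := by
          intro i
          simp }
    have hGE : G.graph = E := by
      ext i j
      change 0 < G.W i j ↔ E.Adj i j
      by_cases h : E.Adj i j
      · simpa [G, h] using hw ⟨s(i, j), h⟩
      · simp [G, h]
    refine ⟨G, hGE.le, hGE ▸ hE.connected, ?_⟩
    rw [laplacian_eq_weightedLap G hGE.le]
    congr 1
    ext e
    have h := adj_out_edge e
    simp only [G, Matrix.of_apply, dif_pos h]
    congr 1
    exact Subtype.ext (mk_out_edge e).symm

/-- In the variable `t = w e * h e` each edge contributes `t - log t`, whose strict minimum on the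
positive reals is at `t = 1`. -/
theorem isCGLE_iff_of_isTree (hE : E.IsTree) {n : ℕ} {x : Fin n → Fin p → ℝ}
    (hx : ∀ e : E.edgeSet, 0 < dataDist x (Quot.out e.1).1 (Quot.out e.1).2)
    (L : Matrix (Fin p) (Fin p) ℝ) :
    IsCGLE E (sampleCov x) L ↔
      L = weightedLap E fun e => (dataDist x (Quot.out e.1).1 (Quot.out e.1).2)⁻¹ := by
  set h : E.edgeSet → ℝ := fun e => dataDist x (Quot.out e.1).1 (Quot.out e.1).2 with hh
  set κ := Real.log ((orientedIncMatrix E)ᵀ * orientedIncMatrix E).det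
  have hobj : ∀ w : E.edgeSet → ℝ, (∀ e, 0 < w e) →
      - Real.log (pdet (weightedLap E w)) + (weightedLap E w * sampleCov x).trace
        = - κ + ∑ e, Real.log (h e) + ∑ e, (w e * h e - Real.log (w e * h e)) := by
    intro w hw
    rw [log_pdet_weightedLap hE hw, trace_weightedLap_mul]
    simp only [transpose_mul_sampleCov_mul]
    have : ∀ e, w e * h e - Real.log (w e * h e)
        = w e * h e - Real.log (w e) - Real.log (h e) := by
      intro e
      rw [Real.log_mul (hw e).ne' (hx e).ne']
      ring
    simp only [this, Finset.sum_sub_distrib]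
    ring
  have hinv : ∀ e, 0 < (h e)⁻¹ := fun e => inv_pos.2 (hx e)
  have hinvmul : ∀ e, (h e)⁻¹ * h e = 1 := fun e => inv_mul_cancel₀ (hx e).ne'
  have hge : ∀ t : ℝ, 0 < t → 1 ≤ t - Real.log t := fun t ht => by
    linarith [Real.log_le_sub_one_of_pos ht]
  rw [IsCGLE, laplacianSet_eq_of_isTree hE]
  constructor
  · rintro ⟨⟨w, hw, rfl⟩, hmin⟩
    have h1 := hmin ⟨fun e => (h e)⁻¹, hinv, rfl⟩
    simp only [Set.mem_ofPred_eq] at h1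
    rw [hobj w hw, hobj _ hinv] at h1
    simp only [hinvmul, Real.log_one, sub_zero] at h1
    congr 1
    ext e
    by_contra hne
    have hlt : ∑ _e : E.edgeSet, (1 : ℝ) < ∑ e, (w e * h e - Real.log (w e * h e)) := by
      refine Finset.sum_lt_sum (fun e _ => hge _ (mul_pos (hw e) (hx e))) ⟨e, Finset.mem_univ e, ?_⟩
      have hne1 : w e * h e ≠ 1 := fun h' => hne (eq_inv_of_mul_eq_one_left h')
      linarith [Real.log_lt_sub_one_of_pos (mul_pos (hw e) (hx e)) hne1]
    linarith
  · rintro rfl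
    refine ⟨⟨_, hinv, rfl⟩, ?_⟩
    rintro _ ⟨w, hw, rfl⟩
    simp only [Set.mem_ofPred_eq]
    rw [hobj w hw, hobj _ hinv]
    simp only [hinvmul, Real.log_one, sub_zero]
    gcongr with e
    exact hge _ (mul_pos (hw e) (hx e))

end TreeLaplacian

/-! ### A Bernstein type inequality -/

theorem Real.exp_le_one_add_add_sq_mul_exp_abs (y : ℝ) :
    Real.exp y ≤ 1 + y + y ^ 2 * Real.exp |y| := by
  have h := Complex.norm_exp_sub_sum_le_norm_mul_exp (y : ℂ) 2
  have h2 : Complex.exp y - ∑ m ∈ Finset.range 2, (y : ℂ) ^ m / m.factorial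
      = ((Real.exp y - (1 + y) : ℝ) : ℂ) := by
    simp [Finset.sum_range_succ]
  rw [h2, Complex.norm_real, Complex.norm_real, Real.norm_eq_abs, Real.norm_eq_abs, sq_abs] at h
  linarith [le_abs_self (Real.exp y - (1 + y))]

/-- The constant in the quadratic bound for the logarithm of the moment generating function of a
centered nonnegative variable `Z` with `𝔼 exp (a Z) ≤ 2`. -/
noncomputable def subExpConst (a : ℝ) : ℝ := 16 * Real.exp a / a ^ 2

theorem subExpConst_pos {a : ℝ} (ha : 0 < a) : 0 < subExpConst a := by
  unfold subExpConst
  positivity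

/-- This places every deviation `t ≤ 1` in the Bernstein range `t ≤ 2 * K * b` with `b = a / 2`. -/
theorem one_le_subExpConst_mul {a : ℝ} (ha : 0 < a) : 1 ≤ subExpConst a * a := by
  have h : subExpConst a * a = 16 * Real.exp a / a := by
    unfold subExpConst
    field_simp
  rw [h, le_div_iff₀ ha]
  linarith [Real.add_one_le_exp a]

section Bernstein

variable {Ω : Type*} [MeasurableSpace Ω] {μ : Measure Ω} [IsProbabilityMeasure μ]

/-- In the second-order bound for `exp`, the linear term has mean zero. In the remainder, the square
and the exponential each cost at most `exp (a / 2 * (Z + 1))` up to constants, which together use up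
exactly the available moment `exp (a Z)`. -/
theorem integrable_exp_and_mgf_sub_one_le {a : ℝ} (ha : 0 < a) {Z : Ω → ℝ} (hZ : AEMeasurable Z μ)
    (hZ0 : ∀ ω, 0 ≤ Z ω) (hexp : ∫⁻ ω, ENNReal.ofReal (Real.exp (a * Z ω)) ∂μ ≤ 2)
    (hmean : ∫ ω, Z ω ∂μ = 1) {l : ℝ} (hl : |l| ≤ a / 2) :
    Integrable (fun ω => Real.exp (l * (Z ω - 1))) μ ∧
      mgf (fun ω => Z ω - 1) μ l ≤ Real.exp (subExpConst a * l ^ 2) := by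
  have hint : Integrable (fun ω => Real.exp (a * Z ω)) μ := by
    refine ⟨(hZ.const_mul a).exp.aestronglyMeasurable, ?_⟩
    rw [hasFiniteIntegral_iff_ofReal (Filter.Eventually.of_forall fun ω => (Real.exp_pos _).le)]
    exact hexp.trans_lt (by simp)
  have hint2 : ∫ ω, Real.exp (a * Z ω) ∂μ ≤ 2 := by
    rw [integral_eq_lintegral_of_nonneg_ae (Filter.Eventually.of_forall fun ω => (Real.exp_pos _).le)
      (hZ.const_mul a).exp.aestronglyMeasurable]
    exact ENNReal.toReal_le_of_le_ofReal (by norm_num) (by simpa using hexp)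
  have hZint : Integrable Z μ := by
    refine (hint.const_mul a⁻¹).mono' hZ.aestronglyMeasurable
      (Filter.Eventually.of_forall fun ω => ?_)
    rw [Real.norm_eq_abs, abs_of_nonneg (hZ0 ω), ← div_eq_inv_mul, le_div_iff₀ ha]
    linarith [Real.add_one_le_exp (a * Z ω), mul_comm a (Z ω)]
  have hpt : ∀ ω, Real.exp (l * (Z ω - 1))
      ≤ 1 + l * (Z ω - 1) + l ^ 2 * (8 * Real.exp a / a ^ 2) * Real.exp (a * Z ω) := by
    intro ω
    have hz := hZ0 ω
    refine (Real.exp_le_one_add_add_sq_mul_exp_abs _).trans ?_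
    have habs : |Z ω - 1| ≤ Z ω + 1 := abs_le.2 ⟨by linarith, by linarith⟩
    have h1 : |l * (Z ω - 1)| ≤ a / 2 * (Z ω + 1) := by
      rw [abs_mul]
      exact mul_le_mul hl habs (abs_nonneg _) (by positivity)
    have h2 : (Z ω - 1) ^ 2 ≤ 8 / a ^ 2 * Real.exp (a / 2 * (Z ω + 1)) := by
      have h3 := Real.quadratic_le_exp_of_nonneg (x := a / 2 * (Z ω + 1)) (by positivity)
      have h4 : (Z ω - 1) ^ 2 ≤ (Z ω + 1) ^ 2 := by nlinarith
      have h5 : 0 ≤ a / 2 * (Z ω + 1) := by positivity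
      rw [div_mul_eq_mul_div, le_div_iff₀ (by positivity)]
      nlinarith [mul_le_mul_of_nonneg_right h4 (sq_nonneg a)]
    have h6 : Real.exp (a / 2 * (Z ω + 1)) * Real.exp (a / 2 * (Z ω + 1))
        = Real.exp a * Real.exp (a * Z ω) := by
      rw [← Real.exp_add, ← Real.exp_add]
      congr 1
      ring
    have h7 : (l * (Z ω - 1)) ^ 2 * Real.exp |l * (Z ω - 1)|
        ≤ l ^ 2 * (8 * Real.exp a / a ^ 2) * Real.exp (a * Z ω) := by
      calc _ ≤ l ^ 2 * (8 / a ^ 2 * Real.exp (a / 2 * (Z ω + 1)))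
              * Real.exp (a / 2 * (Z ω + 1)) := by
            rw [mul_pow]
            gcongr
        _ = l ^ 2 * (8 / a ^ 2) * (Real.exp (a / 2 * (Z ω + 1))
              * Real.exp (a / 2 * (Z ω + 1))) := by ring
        _ = _ := by rw [h6]; ring
    linarith
  have hlin : Integrable (fun ω => l * (Z ω - 1)) μ :=
    (hZint.sub (integrable_const 1)).const_mul l
  have hbase : Integrable (fun ω => 1 + l * (Z ω - 1)) μ := (integrable_const 1).add hlin
  have hbd : Integrable (fun ω => 1 + l * (Z ω - 1)
      + l ^ 2 * (8 * Real.exp a / a ^ 2) * Real.exp (a * Z ω)) μ :=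
    hbase.add (hint.const_mul _)
  have hI : Integrable (fun ω => Real.exp (l * (Z ω - 1))) μ := by
    refine hbd.mono' ((hZ.sub_const 1).const_mul l).exp.aestronglyMeasurable
      (Filter.Eventually.of_forall fun ω => ?_)
    rw [Real.norm_eq_abs, abs_of_pos (Real.exp_pos _)]
    exact hpt ω
  refine ⟨hI, ?_⟩
  calc mgf (fun ω => Z ω - 1) μ l
      ≤ ∫ ω, (1 + l * (Z ω - 1) + l ^ 2 * (8 * Real.exp a / a ^ 2) * Real.exp (a * Z ω)) ∂μ :=
        integral_mono hI hbd hpt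
    _ = 1 + l ^ 2 * (8 * Real.exp a / a ^ 2) * ∫ ω, Real.exp (a * Z ω) ∂μ := by
        rw [integral_add hbase (hint.const_mul _), integral_add (integrable_const 1) hlin,
          integral_const_mul, integral_const_mul, integral_sub hZint (integrable_const 1), hmean]
        simp
    _ ≤ 1 + l ^ 2 * (8 * Real.exp a / a ^ 2) * 2 := by gcongr
    _ = subExpConst a * l ^ 2 + 1 := by
        unfold subExpConst
        ring
    _ ≤ Real.exp (subExpConst a * l ^ 2) := Real.add_one_le_exp _

theorem measureReal_abs_sum_ge_le {ι : Type*} [Fintype ι] {U : ι → Ω → ℝ} (hind : iIndepFun U μ)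
    (hmeas : ∀ k, AEMeasurable (U k) μ) {b K : ℝ} (hK : 0 < K)
    (hint : ∀ k l, |l| ≤ b → Integrable (fun ω => Real.exp (l * U k ω)) μ)
    (hmgf : ∀ k l, |l| ≤ b → mgf (U k) μ l ≤ Real.exp (K * l ^ 2))
    {t : ℝ} (ht : 0 ≤ t) (htb : t ≤ 2 * K * b) :
    μ.real {ω | Fintype.card ι * t ≤ |∑ k, U k ω|}
      ≤ 2 * Real.exp (- (Fintype.card ι * t ^ 2 / (4 * K))) := by
  -- Chernoff parameter: `t / (2 * K)` minimizes `K l² - l t`.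
  have hl0 : 0 ≤ t / (2 * K) := by positivity
  have hlb : t / (2 * K) ≤ b := by
    rw [div_le_iff₀ (by positivity)]
    linarith
  have hI : ∀ l, |l| ≤ b → Integrable (fun ω => Real.exp (l * (∑ k, U k) ω)) μ := by
    intro l hl
    -- A non-integrable function has integral `0` by convention, while this one factors into
    -- positive terms.
    refine Integrable.of_integral_ne_zero ?_
    change mgf (∑ k, U k) μ l ≠ 0
    rw [hind.mgf_sum₀ hmeas]
    exact Finset.prod_ne_zero_iff.2 fun k _ => (mgf_pos (hint k l hl)).ne'
  have hM : ∀ l, |l| ≤ b → mgf (∑ k, U k) μ l ≤ Real.exp (Fintype.card ι * (K * l ^ 2)) := by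
    intro l hl
    rw [hind.mgf_sum₀ hmeas, Real.exp_nat_mul, ← Finset.card_univ, ← Finset.prod_const]
    exact Finset.prod_le_prod (fun k _ => mgf_nonneg) fun k _ => hmgf k l hl
  have habs : |t / (2 * K)| ≤ b := by rwa [abs_of_nonneg hl0]
  have habs' : |-(t / (2 * K))| ≤ b := by rwa [abs_neg]
  have hcalc : -(t / (2 * K)) * (Fintype.card ι * t) + Fintype.card ι * (K * (t / (2 * K)) ^ 2)
      = - (Fintype.card ι * t ^ 2 / (4 * K)) := by
    field_simp
    ring
  have h1 : μ.real {ω | Fintype.card ι * t ≤ (∑ k, U k) ω}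
      ≤ Real.exp (- (Fintype.card ι * t ^ 2 / (4 * K))) := by
    refine (measure_ge_le_exp_mul_mgf _ hl0 (hI _ habs)).trans ?_
    rw [← hcalc, Real.exp_add]
    gcongr
    exact hM _ habs
  have h2 : μ.real {ω | (∑ k, U k) ω ≤ -(Fintype.card ι * t)}
      ≤ Real.exp (- (Fintype.card ι * t ^ 2 / (4 * K))) := by
    refine (measure_le_le_exp_mul_mgf _ (neg_nonpos.2 hl0) (hI _ habs')).trans ?_
    rw [← hcalc, Real.exp_add]
    refine mul_le_mul (le_of_eq (by congr 1; ring)) ?_ mgf_nonneg (Real.exp_pos _).le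
    refine (hM _ habs').trans (le_of_eq ?_)
    congr 1
    ring
  have hsub : {ω | Fintype.card ι * t ≤ |∑ k, U k ω|}
      ⊆ {ω | Fintype.card ι * t ≤ (∑ k, U k) ω} ∪ {ω | (∑ k, U k) ω ≤ -(Fintype.card ι * t)} := by
    intro ω hω
    simp only [Set.mem_union, Set.mem_ofPred_eq, Finset.sum_apply] at hω ⊢
    rcases le_abs.1 hω with h | h
    · exact Or.inl h
    · exact Or.inr (by linarith)
  calc _ ≤ _ := measureReal_mono hsub
    _ ≤ _ := measureReal_union_le _ _
    _ ≤ _ := by linarith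

end Bernstein

/-! ### Concentration of the data distances -/

theorem SubGaussianLaw.integral_dotProduct_sq {p : ℕ} {c₀ c₁ : ℝ} {Sig : Matrix (Fin p) (Fin p) ℝ}
    {ν : Measure (Fin p → ℝ)} [IsProbabilityMeasure ν] (hν : SubGaussianLaw c₀ c₁ Sig ν)
    (u : Fin p → ℝ) : ∫ v, (u ⬝ᵥ v) ^ 2 ∂ν = u ⬝ᵥ Sig *ᵥ u := by
  have hcov : ∀ i j, ∫ v, v i * v j ∂ν = Sig i j := by
    intro i j
    have h := hν.covariance_eq i j
    rw [covariance_eq_sub (hν.memLp i) (hν.memLp j), hν.mean_zero i, zero_mul, sub_zero] at h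
    exact h
  have hI : ∀ i j, Integrable (fun v : Fin p → ℝ => v i * v j) ν := fun i j =>
    (hν.memLp i).integrable_mul (hν.memLp j)
  have hexpand : ∀ v : Fin p → ℝ, (u ⬝ᵥ v) ^ 2 = ∑ i, ∑ j, (u i * u j) * (v i * v j) := by
    intro v
    rw [sq, dotProduct, Finset.sum_mul_sum]
    exact Finset.sum_congr rfl fun i _ => Finset.sum_congr rfl fun j _ => by ring
  simp only [hexpand]
  rw [integral_finsetSum _ fun i _ => integrable_finsetSum _ fun j _ => (hI i j).const_mul _]
  simp only [dotProduct, Matrix.mulVec, Finset.mul_sum]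
  refine Finset.sum_congr rfl fun i _ => ?_
  rw [integral_finsetSum _ fun j _ => (hI i j).const_mul _]
  refine Finset.sum_congr rfl fun j _ => ?_
  rw [integral_const_mul, hcov]
  ring

theorem SubGaussianLaw.lintegral_exp_le_two {p : ℕ} {c₀ c₁ : ℝ} (hc₁ : 0 < c₁)
    {Sig : Matrix (Fin p) (Fin p) ℝ} {ν : Measure (Fin p → ℝ)} (hν : SubGaussianLaw c₀ c₁ Sig ν)
    (u : Fin p → ℝ) {w : ℝ} (hw : 0 < w) (hu : ∫ v, (u ⬝ᵥ v) ^ 2 ∂ν = w⁻¹) :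
    ∫⁻ v, ENNReal.ofReal (Real.exp (c₁ / 2 * (w * (u ⬝ᵥ v) ^ 2))) ∂ν ≤ 2 := by
  have h := hν.psiTwo_le u
  rw [hu] at h
  -- The infimum in the norm is not known to be attained; the factor `2` leaves strict room for an
  -- admissible `t < s`, at the price of `c₁ / 2` in the exponent.
  set s := Real.sqrt (2 * (w⁻¹ / c₁)) with hs
  have hpos : 0 < 2 * (w⁻¹ / c₁) := by positivity
  have hs0 : 0 < s := Real.sqrt_pos.2 hpos
  have hs2 : s ^ 2 = 2 * (w⁻¹ / c₁) := Real.sq_sqrt hpos.le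
  have hlt : psiTwoNorm (fun v => u ⬝ᵥ v) ν < ENNReal.ofReal s := by
    by_contra! hcon
    have h1 : ENNReal.ofReal s ^ 2 ≤ ENNReal.ofReal (w⁻¹ / c₁) :=
      (pow_le_pow_left₀ zero_le hcon 2).trans h
    rw [← ENNReal.ofReal_pow hs0.le, hs2, ENNReal.ofReal_le_ofReal_iff (by positivity)] at h1
    linarith
  unfold psiTwoNorm at hlt
  simp only [iInf_lt_iff] at hlt
  obtain ⟨t, ht0, ht, hts⟩ := hlt
  rw [ENNReal.ofReal_lt_ofReal_iff hs0] at hts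
  refine (lintegral_mono fun v => ?_).trans ht
  refine ENNReal.ofReal_le_ofReal (Real.exp_le_exp.2 ?_)
  rw [le_div_iff₀ (by positivity)]
  have ht2 : t ^ 2 ≤ 2 * (w⁻¹ / c₁) := by
    rw [← hs2]
    gcongr
  calc c₁ / 2 * (w * (u ⬝ᵥ v) ^ 2) * t ^ 2
      ≤ c₁ / 2 * (w * (u ⬝ᵥ v) ^ 2) * (2 * (w⁻¹ / c₁)) := by gcongr
    _ = (u ⬝ᵥ v) ^ 2 := by field_simp

theorem SubGaussianLaw.measureReal_abs_sum_sq_ge_le {p n : ℕ} {c₀ c₁ : ℝ} (hc₁ : 0 < c₁)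
    {Sig : Matrix (Fin p) (Fin p) ℝ} {ν : Measure (Fin p → ℝ)} [IsProbabilityMeasure ν]
    (hν : SubGaussianLaw c₀ c₁ Sig ν) {Ω : Type*} [MeasurableSpace Ω] {μ : Measure Ω}
    [IsProbabilityMeasure μ] {X : Fin n → Ω → Fin p → ℝ} (hX : ∀ k, HasLaw (X k) ν μ)
    (hind : iIndepFun X μ) (u : Fin p → ℝ) {w : ℝ} (hw : 0 < w) (hu : u ⬝ᵥ Sig *ᵥ u = w⁻¹)
    {t : ℝ} (ht : 0 ≤ t) (ht1 : t ≤ 1) :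
    μ.real {ω | n * t ≤ |∑ k, (w * (u ⬝ᵥ X k ω) ^ 2 - 1)|}
      ≤ 2 * Real.exp (- (n * t ^ 2 / (4 * subExpConst (c₁ / 2)))) := by
  have ha : 0 < c₁ / 2 := by positivity
  have hu' := hν.integral_dotProduct_sq u
  rw [hu] at hu'
  have hmeas : Measurable fun v : Fin p → ℝ => w * (u ⬝ᵥ v) ^ 2 := by
    unfold dotProduct
    fun_prop
  have key := fun l (hl : |l| ≤ c₁ / 2 / 2) => integrable_exp_and_mgf_sub_one_le ha
    hmeas.aemeasurable (fun v => by positivity) (hν.lintegral_exp_le_two hc₁ u hw hu')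
    (by rw [integral_const_mul, hu', mul_inv_cancel₀ hw.ne']) hl
  have h := measureReal_abs_sum_ge_le (μ := μ) (b := c₁ / 2 / 2)
    (U := fun k ω => w * (u ⬝ᵥ X k ω) ^ 2 - 1)
    (hind.comp (fun _ v => w * (u ⬝ᵥ v) ^ 2 - 1) fun _ => hmeas.sub_const 1)
    (fun k => (hmeas.sub_const 1).comp_aemeasurable (hX k).aemeasurable) (subExpConst_pos ha)
    (fun k l hl => ?_) (fun k l hl => ?_) ht ?_
  · simpa using h
  · have h1 := (key l hl).1
    rw [← (hX k).map_eq] at h1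
    exact h1.comp_aemeasurable (hX k).aemeasurable
  · have h1 := (key l hl).2
    rw [← (hX k).map_eq, mgf_map (hX k).aemeasurable] at h1
    · exact h1
    · exact ((hmeas.sub_const 1).const_mul l).exp.aestronglyMeasurable
  · linarith [one_le_subExpConst_mul ha]

theorem dotProduct_col_orientedIncMatrix {V : Type*} [Fintype V] [DecidableEq V]
    {E : SimpleGraph V} (e : E.edgeSet) (x : V → ℝ) :
    (fun v => orientedIncMatrix E v e) ⬝ᵥ x = x (Quot.out e.1).1 - x (Quot.out e.1).2 :=
  transpose_orientedIncMatrix_mulVec E x e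

/-! ### From close data distances to a small loss -/

theorem add_inv_sub_two_le {s δ : ℝ} (hδ : δ ≤ 1 / 2) (hs : |s - 1| ≤ δ) :
    s + s⁻¹ - 2 ≤ 2 * δ ^ 2 := by
  obtain ⟨h1, h2⟩ := abs_le.1 hs
  have hs0 : 0 < s := by linarith
  have h3 : (s - 1) ^ 2 ≤ δ ^ 2 := by
    rw [← sq_abs]
    gcongr
  have h4 : s + s⁻¹ - 2 = (s - 1) ^ 2 / s := by
    field_simp
    ring
  rw [h4, div_le_iff₀ hs0]
  nlinarith [sq_nonneg δ]

/-- As `δ < 1`, all distances on edges are positive, so the explicit estimator applies; each edge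
then costs at most `2 δ²` in the loss formula. -/
theorem tree_estimator_of_dataDist_close {p n : ℕ} (hp : 2 ≤ p) {E : SimpleGraph (Fin p)}
    [Fintype E.edgeSet] (hE : E.IsTree) {w : E.edgeSet → ℝ} (hw : ∀ e, 0 < w e)
    {x : Fin n → Fin p → ℝ} {δ : ℝ} (hδ : δ ≤ 1 / 2)
    (hx : ∀ e, |w e * dataDist x (Quot.out e.1).1 (Quot.out e.1).2 - 1| ≤ δ) :
    E ≤ dataGraph x ∧ (∃! L, IsCGLE E (sampleCov x) L) ∧
      ∀ L, IsCGLE E (sampleCov x) L → symSteinLoss L (weightedLap E w) ≤ δ ^ 2 := by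
  have hpos : ∀ e : E.edgeSet, 0 < dataDist x (Quot.out e.1).1 (Quot.out e.1).2 := by
    intro e
    have := (abs_le.1 (hx e)).1
    exact pos_of_mul_pos_right (by linarith) (hw e).le
  refine ⟨?_, ?_, ?_⟩
  · intro i j hij
    have h := hpos ⟨s(i, j), hij⟩
    have h2 := mk_out_edge (E := E) ⟨s(i, j), hij⟩
    rw [Sym2.eq_iff] at h2
    rcases h2 with ⟨h3, h4⟩ | ⟨h3, h4⟩ <;> rw [h3, h4] at h
    · exact h
    · exact (dataGraph x).symm.symm _ _ h
  · exact ⟨_, (isCGLE_iff_of_isTree hE hpos _).2 rfl,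
      fun L hL => (isCGLE_iff_of_isTree hE hpos L).1 hL⟩
  · intro L hL
    rw [(isCGLE_iff_of_isTree hE hpos L).1 hL,
      symSteinLoss_weightedLap hp hE (fun e => inv_pos.2 (hpos e)) hw]
    have hp1 : (0 : ℝ) < (p : ℝ) - 1 := by
      have : (2 : ℝ) ≤ p := by exact_mod_cast hp
      linarith
    have hcard : (Fintype.card E.edgeSet : ℝ) = (p : ℝ) - 1 := by
      have := hE.card_edgeSet
      rw [Fintype.card_fin] at this
      rw [eq_sub_iff_add_eq]
      exact_mod_cast this
    rw [div_le_iff₀ (by positivity)]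
    calc _ ≤ ∑ _e : E.edgeSet, 2 * δ ^ 2 := by
          refine Finset.sum_le_sum fun e _ => ?_
          refine le_trans (le_of_eq ?_) (add_inv_sub_two_le hδ (hx e))
          rw [mul_inv, div_inv_eq_mul, div_eq_mul_inv]
          ring
      _ = _ := by
          rw [Finset.sum_const, Finset.card_univ, nsmul_eq_mul, hcard]
          ring

theorem theorem3 (c₀ c₁ : ℝ) (hc₀ : 0 < c₀) (hc₁ : 0 < c₁) :
    ∃ c C : ℝ, 0 < c ∧ 0 < C ∧
      ∀ (p n : ℕ) (Gstar : WeightedGraph p) (E : SimpleGraph (Fin p))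
        (ν : Measure (Fin p → ℝ)) [IsProbabilityMeasure ν]
        (Ω : Type*) [MeasurableSpace Ω] (μ : Measure Ω) [IsProbabilityMeasure μ]
        (X : Fin n → Ω → Fin p → ℝ),
        2 ≤ p →
        Gstar.graph.IsTree →
        Gstar.graph = E →
        SubGaussianLaw c₀ c₁ (pinv Gstar.laplacian) ν →
        (∀ k, HasLaw (X k) ν μ) →
        iIndepFun X μ →
        c * Real.log p ≤ n →
        ∃ A : Set Ω, MeasurableSet A ∧ 1 - 2 / (p : ℝ) ^ 2 ≤ μ.real A ∧
          ∀ ω ∈ A,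
            E ≤ dataGraph (fun k => X k ω) ∧
            (∃! Lhat, IsCGLE E (sampleCov fun k => X k ω) Lhat) ∧
            ∀ Lhat, IsCGLE E (sampleCov fun k => X k ω) Lhat →
              symSteinLoss Lhat Gstar.laplacian ≤ C * (Real.log p / n) := by
  classical
  set K := subExpConst (c₁ / 2) with hK
  have hK0 : 0 < K := subExpConst_pos (by positivity)
  -- With `δ² = 12 K log p / n` the Bernstein exponent is `3 log p`, so each edge fails with
  -- probability at most `2 / p³`, leaving `2 / p²` after the union bound. The factor `48` makes `δ
  -- ≤ 1 / 2`.
  refine ⟨48 * K, 12 * K, by positivity, by positivity, ?_⟩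
  intro p n Gstar E ν _ Ω _ μ _ X hp htree hGE hν hX hind hn
  subst hGE
  set E := Gstar.graph with hEdef
  have hp2 : (2 : ℝ) ≤ p := by exact_mod_cast hp
  have hlog : 0 < Real.log p := Real.log_pos (by linarith)
  have hn0 : (0 : ℝ) < n := lt_of_lt_of_le (by positivity) hn
  set w : E.edgeSet → ℝ := fun e => Gstar.W (Quot.out e.1).1 (Quot.out e.1).2 with hwdef
  have hw : ∀ e, 0 < w e := fun e => adj_out_edge e
  have hL : Gstar.laplacian = weightedLap E w := laplacian_eq_weightedLap Gstar le_rfl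
  rw [hL] at hν ⊢
  set δ := Real.sqrt (12 * K * (Real.log p / n)) with hδdef
  have hδ0 : 0 ≤ δ := Real.sqrt_nonneg _
  have hδ2 : δ ^ 2 = 12 * K * (Real.log p / n) := Real.sq_sqrt (by positivity)
  have hδ : δ ≤ 1 / 2 := by
    refine Real.sqrt_le_iff.2 ⟨by norm_num, ?_⟩
    rw [← mul_div_assoc, div_le_iff₀ hn0]
    linarith
  set bad : E.edgeSet → Set Ω := fun e =>
    {ω | n * δ ≤ |∑ k, (w e * ((fun v => orientedIncMatrix E v e) ⬝ᵥ X k ω) ^ 2 - 1)|} with hbad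
  have hbadle : ∀ e, μ.real (bad e) ≤ 2 / (p : ℝ) ^ 3 := by
    intro e
    have hu : (fun v => orientedIncMatrix E v e) ⬝ᵥ
        pinv (weightedLap E w) *ᵥ (fun v => orientedIncMatrix E v e) = (w e)⁻¹ := by
      have h := congrFun (congrFun (transpose_mul_pinv_weightedLap_mul htree hw) e) e
      rw [Matrix.diagonal_apply_eq, Matrix.mul_assoc] at h
      exact h
    refine (hν.measureReal_abs_sum_sq_ge_le hc₁ hX hind _ (hw e) hu hδ0 (by linarith)).trans ?_
    rw [← hK, hδ2]
    have h1 : n * (12 * K * (Real.log p / n)) / (4 * K) = 3 * Real.log p := by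
      field_simp
      norm_num
    have h2 : Real.exp (3 * Real.log p) = (p : ℝ) ^ 3 := by
      have := Real.exp_nat_mul (Real.log p) 3
      rw [Real.exp_log (by linarith)] at this
      exact_mod_cast this
    rw [h1, Real.exp_neg, h2, div_eq_mul_inv]
  have hcard : (Fintype.card E.edgeSet : ℝ) ≤ p := by
    have := htree.card_edgeSet
    rw [Fintype.card_fin] at this
    exact_mod_cast (by omega : Fintype.card E.edgeSet ≤ p)
  have hunion : μ.real (⋃ e, bad e) ≤ 2 / (p : ℝ) ^ 2 := by
    calc μ.real (⋃ e, bad e) ≤ ∑ e, μ.real (bad e) := measureReal_iUnion_fintype_le _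
      _ ≤ ∑ _e : E.edgeSet, 2 / (p : ℝ) ^ 3 := Finset.sum_le_sum fun e _ => hbadle e
      _ = Fintype.card E.edgeSet * (2 / (p : ℝ) ^ 3) := by
          rw [Finset.sum_const, Finset.card_univ, nsmul_eq_mul]
      _ ≤ p * (2 / (p : ℝ) ^ 3) := by gcongr
      _ = 2 / (p : ℝ) ^ 2 := by field_simp
  -- The data are only almost everywhere measurable, so the bad event is replaced by a measurable
  -- hull of equal measure.
  refine ⟨(toMeasurable μ (⋃ e, bad e))ᶜ, (measurableSet_toMeasurable _ _).compl, ?_, ?_⟩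
  · rw [probReal_compl_eq_one_sub (measurableSet_toMeasurable _ _), Measure.real,
      measure_toMeasurable]
    exact sub_le_sub_left hunion 1
  · intro ω hω
    rw [← hδ2]
    refine tree_estimator_of_dataDist_close hp htree hw hδ fun e => ?_
    have hωe : ω ∉ bad e := fun h => hω (subset_toMeasurable _ _ (Set.mem_iUnion.2 ⟨e, h⟩))
    simp only [hbad, Set.mem_ofPred_eq, not_le, dotProduct_col_orientedIncMatrix] at hωe
    have hsum : ∑ k, (w e * (X k ω (Quot.out e.1).1 - X k ω (Quot.out e.1).2) ^ 2 - 1)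
        = n * (w e * dataDist (fun k => X k ω) (Quot.out e.1).1 (Quot.out e.1).2 - 1) := by
      rw [Finset.sum_sub_distrib, ← Finset.mul_sum, dataDist]
      simp only [Finset.sum_const, Finset.card_univ, Fintype.card_fin, nsmul_eq_mul, mul_one]
      field_simp
    rw [hsum, abs_mul, abs_of_pos hn0] at hωe
    exact (lt_of_mul_lt_mul_left hωe hn0.le).le
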